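/- Let $0<q<1$. Let $G=(V,E)$ be a simple, undirected, connected graph with $n\ge 2$ nodes and $m$ edges, let $\mathcal A$ be a finite set of alternatives, and let $\mathcal P_0$ be an initial profile, i.e., an assignment of a strict linear order on $\mathcal A$ to every node. In the Random Preference Diffusion process with update probability $q$, started from $\mathcal P_0$, in each round every node independently does the following: with probability $1-q$ it keeps its order; with probability $q$ it picks one of its neighbours uniformly at random and replaces its order by the order which that neighbour had at the end of the previous round. Let $\mathcal P_t$ be the profile after round $t$. A profile is fixed if, with probability one, a round started from it leaves it unchanged. Then: 1. Almost surely the process reaches a fixed profile, in which all nodes have one and the same (random) order $\succ^f$. 2. For all $a,b\in\mathcal A$, $\mathbb P[a\succ^f b]=Z_0^{ab}/(2m)$, where $Z_0^{ab}$ is the sum of the degrees of the nodes that rank $a$ higher than $b$ in $\mathcal P_0$. 3. The expected number of rounds until a fixed profile is reached is $\mathcal O(n^4)$: it is at most $C n^4$ with a constant $C$ that depends only on $q$ (and not on $G$, $\mathcal A$ or $\mathcal P_0$). -/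

import Mathlib

open MeasureTheory ProbabilityTheory
open scoped NNReal ENNReal

universe u v w

/-- A strict linear order on the set `A` of alternatives; `r.1 a b` means that `a` is preferred
over `b`. -/
def StrictOrder (A : Type*) : Type _ := {r : A → A → Prop // IsStrictTotalOrder A r}

/-- The set of strict linear orders (finite when `A` is) carries the discrete σ-algebra. -/
instance (A : Type*) : MeasurableSpace (StrictOrder A) := ⊤

instance (A : Type*) : DiscreteMeasurableSpace (StrictOrder A) := ⟨fun _ => trivial⟩

/-- A profile assigns to every node its preference order. -/
abbrev Profile (V A : Type*) : Type _ := V → StrictOrder A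

namespace RandomPD

section Rule

variable {V : Type*} [MeasurableSpace V] (G : SimpleGraph V)

open Classical in
/-- The uniform distribution on the neighbours of `v`. (A node without neighbours has nobody to
choose but itself; this does not occur in a connected graph with at least two nodes.) -/
noncomputable def neighborLaw (v : V) : Measure V :=
  if (G.neighborSet v).Nonempty then uniformOn (G.neighborSet v) else Measure.dirac v

/-- The distribution of the node from which `v` takes its next order: with probability `q` the
node `v` updates and copies a uniformly random neighbour, with probability `1 - q` it keeps its
own order. -/
noncomputable def copyLaw (q : unitInterval) (v : V) : Measure V :=
  unitInterval.toNNReal q • neighborLaw G v +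
    unitInterval.toNNReal (unitInterval.symm q) • Measure.dirac v

instance [Finite V] [DiscreteMeasurableSpace V] (v : V) :
    IsProbabilityMeasure (neighborLaw G v) := by
  unfold neighborLaw
  split_ifs with h
  · exact isProbabilityMeasure_uniformOn (Set.toFinite _) h
  · infer_instance

instance [Finite V] [DiscreteMeasurableSpace V] (q : unitInterval) (v : V) :
    IsProbabilityMeasure (copyLaw G q v) := by
  constructor
  simp only [copyLaw, Measure.add_apply, Measure.smul_apply, measure_univ, smul_eq_mul,
    ENNReal.smul_def, mul_one]
  rw [← ENNReal.coe_add, ← ENNReal.coe_one, ENNReal.coe_inj]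
  ext
  simp

end Rule

/-- The profile after one round in which every node `v` takes over the current order of the
node `s v` (where `s v = v` if `v` does not update). -/
def step {V A : Type*} (P : Profile V A) (s : V → V) : Profile V A := fun v => P (s v)

/-- The successive profiles from the initial profile `P₀` when in round `t + 1` every node `v`
takes over the order of the node `s t v`. -/
def trajectory {V A : Type*} (P₀ : Profile V A) (s : ℕ → V → V) : ℕ → Profile V A
  | 0 => P₀
  | t + 1 => step (trajectory P₀ s t) (s t)

section Diffusion

variable {V A : Type*} [MeasurableSpace V]

theorem measurable_trajectory [Finite V] [DiscreteMeasurableSpace V]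
    (P₀ : Profile V A) :
    Measurable (fun s : ℕ → V → V => trajectory P₀ s) := by
  rw [measurable_pi_iff]
  have key : ∀ t : ℕ, ∀ v : V, Measurable (fun s : ℕ → V → V => trajectory P₀ s t v) := by
    intro t
    induction t with
    | zero => intro v; exact measurable_const
    | succ t ih =>
      intro v
      have h1 : Measurable (fun s : ℕ → V → V => s t v) :=
        (measurable_pi_apply v).comp (measurable_pi_apply t)
      intro S _
      have : (fun s : ℕ → V → V => trajectory P₀ s (t + 1) v) ⁻¹' S =
          ⋃ u : V, ((fun s : ℕ → V → V => s t v) ⁻¹' {u}) ∩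
            ((fun s : ℕ → V → V => trajectory P₀ s t u) ⁻¹' S) := by
        ext s
        simp [trajectory, step]
      rw [this]
      exact MeasurableSet.iUnion fun u =>
        (h1 (MeasurableSet.of_discrete)).inter (ih u MeasurableSet.of_discrete)
  intro t
  rw [measurable_pi_iff]
  exact key t

variable (G : SimpleGraph V) (q : unitInterval)

/-- The joint law of the choices of all nodes in all rounds: they are independent over the
rounds and over the nodes. -/
noncomputable def choicesLaw [Fintype V] : Measure (ℕ → V → V) :=
  Measure.infinitePi fun _ : ℕ => Measure.pi fun v : V => copyLaw G q v

/-- The law of the Random Preference Diffusion process `𝒫₀, 𝒫₁, 𝒫₂, …` on `G` with update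
probability `q` and initial profile `P₀`, as a measure on the space of sequences of profiles. -/
noncomputable def processLaw [Fintype V] (P₀ : Profile V A) : Measure (ℕ → Profile V A) :=
  (choicesLaw G q).map (fun s => trajectory P₀ s)

/-- A profile is fixed if no effective update is possible from it: every combination of choices
that the nodes can make with positive probability leaves the profile as it is. -/
def IsFixed (P : Profile V A) : Prop :=
  ∀ s : V → V, (∀ v, copyLaw G q v {s v} ≠ 0) → step P s = P

/-- The number of rounds until a fixed profile is reached (`∞` if this never happens). -/
noncomputable def convergenceTime (p : ℕ → Profile V A) : ℝ≥0∞ :=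
  ⨅ (t : ℕ) (_ : IsFixed G q (p t)), (t : ℝ≥0∞)

end Diffusion

open Classical in
/-- The sum of the degrees of the nodes that prefer `a` over `b` in the profile `P`. -/
noncomputable def degreeWeight {V A : Type*} [Fintype V]
    (G : SimpleGraph V) (P : Profile V A) (a b : A) : ℕ :=
  ∑ v : V, if (P v).1 a b then G.degree v else 0

end RandomPD

/-! The copying kernel satisfies detailed balance with respect to the degrees, so the degree measure
is stationary (`sum_degree_mul_copyLaw`). Two consequences carry the proof.

Speed: the potential is `agreementWeight`, the sum of `d_v d_w` over ordered pairs of agreeing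
nodes. If `v` and `w` chose independently for all pairs, its mean would be preserved. On the
diagonal `v = w` there is only one choice and agreement is certain, so the true mean is larger.
Without consensus some edge joins disagreeing nodes, and its endpoint alone gains at least `q (1 -
q)` (`agreementWeight_add_le_integral`). The potential lies between `0` and `n ^ 4`, so the expected
number of rounds without consensus is at most `n ^ 4 / (q (1 - q))`. Consensus is absorbing and
fixed, which gives both almost sure convergence and the time bound.

Final law: `degreeWeight` has constant mean, and once consensus holds on an order it equals `2m` or
`0` according to whether that order ranks `a` above `b`. Dominated convergence then identifies the
probability (`measureReal_finalOrder`). -/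

set_option linter.unusedSectionVars false

namespace RandomPD

/-! ### The copying kernel and its stationary degree measure -/

section Kernel

variable {V : Type*} [Fintype V] [DecidableEq V] [MeasurableSpace V] [DiscreteMeasurableSpace V]
  (G : SimpleGraph V) [DecidableRel G.Adj] (q : unitInterval)

theorem neighborLaw_real_singleton {v : V} (hv : 0 < G.degree v) (x : V) :
    (neighborLaw G v).real {x} = if G.Adj v x then (G.degree v : ℝ)⁻¹ else 0 := by
  have hne : (G.neighborSet v).Nonempty := by
    rw [← G.card_neighborFinset_eq_degree, Finset.card_pos] at hv
    obtain ⟨y, hy⟩ := hv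
    exact ⟨y, by simpa using hy⟩
  have hset : G.neighborSet v = (G.neighborFinset v : Set V) := by simp
  have hsing : ({x} : Set V) = (({x} : Finset V) : Set V) := by simp
  have hlaw : uniformOn (G.neighborSet v) {x} =
      ((G.neighborFinset v ∩ {x}).card : ℝ≥0∞) / (G.neighborFinset v).card := by
    rw [← uniformOn_apply_finset, ← hsing]
    exact congrArg (fun s => uniformOn s {x}) hset
  rw [neighborLaw, if_pos hne, measureReal_def, hlaw]
  by_cases hx : G.Adj v x
  · have : G.neighborFinset v ∩ {x} = {x} := by
      ext y; simp; rintro rfl; exact hx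
    simp [this, hx]
  · have : G.neighborFinset v ∩ {x} = ∅ := by
      ext y; simp; rintro h rfl; exact hx h
    simp [this, hx]

theorem copyLaw_real_singleton {v : V} (hv : 0 < G.degree v) (x : V) :
    (copyLaw G q v).real {x} =
      q * (if G.Adj v x then (G.degree v : ℝ)⁻¹ else 0) + (1 - q) * (if v = x then 1 else 0) := by
  rw [copyLaw, measureReal_add_apply, measureReal_nnreal_smul_apply,
    measureReal_nnreal_smul_apply, neighborLaw_real_singleton G hv]
  congr 1
  rw [measureReal_def, Measure.dirac_apply]
  by_cases h : v = x <;> simp [h]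

/-- The degree measure is reversible for the copying kernel. -/
theorem degree_mul_copyLaw_comm (hG : ∀ v, 0 < G.degree v) (v x : V) :
    (G.degree v : ℝ) * (copyLaw G q v).real {x} =
      (G.degree x : ℝ) * (copyLaw G q x).real {v} := by
  have hv : (G.degree v : ℝ) ≠ 0 := by exact_mod_cast (hG v).ne'
  have hx : (G.degree x : ℝ) ≠ 0 := by exact_mod_cast (hG x).ne'
  rw [copyLaw_real_singleton G q (hG v), copyLaw_real_singleton G q (hG x)]
  by_cases h : v = x
  · subst h; rfl
  · by_cases hadj : G.Adj v x
    · simp [h, Ne.symm h, hadj, hadj.symm]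
      field_simp
    · simp [h, Ne.symm h, hadj, G.adj_comm x v]

theorem sum_copyLaw_real (v : V) : ∑ x, (copyLaw G q v).real {x} = 1 := by
  rw [sum_measureReal_singleton]
  simp

theorem sum_degree_mul_copyLaw (hG : ∀ v, 0 < G.degree v) (x : V) :
    ∑ v, (G.degree v : ℝ) * (copyLaw G q v).real {x} = G.degree x := by
  simp_rw [degree_mul_copyLaw_comm G q hG _ x, ← Finset.mul_sum, sum_copyLaw_real, mul_one]

theorem integral_copyLaw (v : V) (f : V → ℝ) :
    ∫ x, f x ∂(copyLaw G q v) = ∑ x, (copyLaw G q v).real {x} * f x := by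
  rw [integral_fintype (Integrable.of_finite)]
  simp

theorem integral_pi_copyLaw_eval (v : V) (f : V → ℝ) :
    ∫ σ, f (σ v) ∂(Measure.pi fun v : V => copyLaw G q v) =
      ∑ x, (copyLaw G q v).real {x} * f x := by
  rw [← integral_copyLaw, ← (measurePreserving_eval (fun v : V => copyLaw G q v) v).map_eq,
    integral_map (measurable_pi_apply v).aemeasurable
      Measurable.of_discrete.aestronglyMeasurable]

/-- Independence needs `v ≠ w`; its failure on the diagonal is the source of the drift. -/
theorem integral_pi_copyLaw_eval₂ {v w : V} (hvw : v ≠ w) (e : V → V → ℝ) :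
    ∫ σ, e (σ v) (σ w) ∂(Measure.pi fun v : V => copyLaw G q v) =
      ∑ x, ∑ y, (copyLaw G q v).real {x} * (copyLaw G q w).real {y} * e x y := by
  have hind : iIndepFun (fun (i : V) (σ : V → V) => σ i) (Measure.pi fun v : V => copyLaw G q v) :=
    iIndepFun_pi (X := fun _ x => x) (fun i => by fun_prop)
  have hmap := (indepFun_iff_map_prod_eq_prod_map_map (measurable_pi_apply v).aemeasurable
    (measurable_pi_apply w).aemeasurable).1
    (hind.indepFun hvw)
  have h1 := (measurePreserving_eval (fun v : V => copyLaw G q v) v).map_eq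
  have h2 := (measurePreserving_eval (fun v : V => copyLaw G q v) w).map_eq
  unfold Function.eval at h1 h2
  rw [h1, h2] at hmap
  have : ∫ σ, e (σ v) (σ w) ∂(Measure.pi fun v : V => copyLaw G q v) =
      ∫ z, e z.1 z.2 ∂((copyLaw G q v).prod (copyLaw G q w)) := by
    rw [← hmap, integral_map
      ((measurable_pi_apply v).prodMk (measurable_pi_apply w)).aemeasurable
      Measurable.of_discrete.aestronglyMeasurable]
  rw [this, integral_prod _ Integrable.of_finite]
  simp_rw [integral_copyLaw, Finset.mul_sum, mul_assoc]

end Kernel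

/-! ### One-round drift of the agreement weight and of the degree weight -/

section Drift

variable {V A : Type*} [Fintype V] [DecidableEq V] (G : SimpleGraph V) [DecidableRel G.Adj]
  (q : unitInterval)

/-- All nodes have the same order. -/
def IsConsensus (P : Profile V A) : Prop := ∀ v w, P v = P w

open Classical in
/-- The indicator of two nodes having the same order. -/
noncomputable def agree (P : Profile V A) (v w : V) : ℝ := if P v = P w then 1 else 0

/-- The sum over the orders of the squared total degree of the nodes with that order. -/
noncomputable def agreementWeight (P : Profile V A) : ℝ :=
  ∑ v, ∑ w, (G.degree v : ℝ) * G.degree w * agree P v w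

theorem agree_nonneg (P : Profile V A) (v w : V) : 0 ≤ agree P v w := by
  unfold agree; split_ifs <;> norm_num

theorem agree_le_one (P : Profile V A) (v w : V) : agree P v w ≤ 1 := by
  unfold agree; split_ifs <;> norm_num

theorem agreementWeight_nonneg (P : Profile V A) : 0 ≤ agreementWeight G P :=
  Finset.sum_nonneg fun v _ => Finset.sum_nonneg fun w _ =>
    mul_nonneg (by positivity) (agree_nonneg P v w)

theorem agreementWeight_le (P : Profile V A) : agreementWeight G P ≤ (Fintype.card V : ℝ) ^ 4 := by
  have hd : ∀ v, G.degree v ≤ Fintype.card V := fun v => (G.degree_lt_card_verts v).le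
  calc agreementWeight G P
      ≤ ∑ _v : V, ∑ _w : V, (Fintype.card V : ℝ) * Fintype.card V * 1 := by
        refine Finset.sum_le_sum fun v _ => Finset.sum_le_sum fun w _ => ?_
        gcongr
        · exact agree_nonneg P v w
        · exact hd v
        · exact hd w
        · exact agree_le_one P v w
    _ = (Fintype.card V : ℝ) ^ 4 := by
        simp; ring

theorem exists_adj_ne_of_not_isConsensus (hG : G.Connected) {P : Profile V A}
    (hP : ¬ IsConsensus P) : ∃ v w, G.Adj v w ∧ P v ≠ P w := by
  by_contra! h
  refine hP fun v w => ?_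
  obtain ⟨p⟩ := hG.preconnected v w
  induction p with
  | nil => rfl
  | cons hadj _ ih => exact (h _ _ hadj).trans ih

variable [MeasurableSpace V] [DiscreteMeasurableSpace V]

/-- The probability that independent copying choices from `v` and `w` hit nodes which agree. -/
noncomputable def copyAgree (P : Profile V A) (v w : V) : ℝ :=
  ∑ x, ∑ y, (copyLaw G q v).real {x} * (copyLaw G q w).real {y} * agree P x y

/-- The product of two degree measures is stationary for two independent copying choices; after
reordering the sums, stationarity applies in `v` and in `w` separately. -/
theorem sum_degree_mul_copyAgree (hG : ∀ v, 0 < G.degree v) (P : Profile V A) :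
    ∑ v, ∑ w, (G.degree v : ℝ) * G.degree w * copyAgree G q P v w = agreementWeight G P := by
  have h : ∀ v w, (G.degree v : ℝ) * G.degree w * copyAgree G q P v w =
      ∑ x, ∑ y, ((G.degree v : ℝ) * (copyLaw G q v).real {x}) *
        ((G.degree w : ℝ) * (copyLaw G q w).real {y}) * agree P x y := fun v w => by
    simp_rw [copyAgree, Finset.mul_sum]
    exact Finset.sum_congr rfl fun x _ => Finset.sum_congr rfl fun y _ => by ring
  simp_rw [h]
  calc _ = ∑ v, ∑ x, ∑ w, ∑ y, ((G.degree v : ℝ) * (copyLaw G q v).real {x}) *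
        ((G.degree w : ℝ) * (copyLaw G q w).real {y}) * agree P x y :=
        Finset.sum_congr rfl fun v _ => Finset.sum_comm
    _ = ∑ x, ∑ v, ∑ y, ∑ w, ((G.degree v : ℝ) * (copyLaw G q v).real {x}) *
        ((G.degree w : ℝ) * (copyLaw G q w).real {y}) * agree P x y := by
        rw [Finset.sum_comm]
        exact Finset.sum_congr rfl fun v _ => Finset.sum_congr rfl fun x _ => Finset.sum_comm
    _ = ∑ x, ∑ y, ∑ v, ∑ w, ((G.degree v : ℝ) * (copyLaw G q v).real {x}) *
        ((G.degree w : ℝ) * (copyLaw G q w).real {y}) * agree P x y :=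
        Finset.sum_congr rfl fun x _ => Finset.sum_comm
    _ = agreementWeight G P := by
        refine Finset.sum_congr rfl fun x _ => Finset.sum_congr rfl fun y _ => ?_
        simp_rw [← Finset.sum_mul, ← Finset.mul_sum, ← Finset.sum_mul,
          sum_degree_mul_copyLaw G q hG]

theorem one_sub_copyAgree_self (P : Profile V A) (v : V) :
    1 - copyAgree G q P v v =
      ∑ x, ∑ y, (copyLaw G q v).real {x} * (copyLaw G q v).real {y} * (1 - agree P x y) := by
  have h1 : ∑ x, ∑ y, (copyLaw G q v).real {x} * (copyLaw G q v).real {y} = 1 := by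
    simp_rw [← Finset.mul_sum, sum_copyLaw_real, mul_one, sum_copyLaw_real]
  simp_rw [mul_sub, mul_one, Finset.sum_sub_distrib, h1, copyAgree]

theorem copyAgree_self_le_one (P : Profile V A) (v : V) : copyAgree G q P v v ≤ 1 := by
  rw [← sub_nonneg, one_sub_copyAgree_self]
  exact Finset.sum_nonneg fun x _ => Finset.sum_nonneg fun y _ =>
    mul_nonneg (by positivity) (sub_nonneg.2 (agree_le_one P x y))

/-- One way for two independent choices from `v` to disagree is that the first stays at `v` and the
second goes to `w`, with probability `(1 - q) * q / d_v`. The factor `d_v ^ 2` absorbs the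
denominator. -/
theorem le_degree_sq_mul_one_sub_copyAgree (hG : ∀ v, 0 < G.degree v) (P : Profile V A) {v w : V}
    (hadj : G.Adj v w) (hP : P v ≠ P w) :
    (q : ℝ) * (1 - q) ≤ (G.degree v : ℝ) * G.degree v * (1 - copyAgree G q P v v) := by
  have hd : (1 : ℝ) ≤ G.degree v := by exact_mod_cast hG v
  have hterm : ∀ x y, 0 ≤ (copyLaw G q v).real {x} * (copyLaw G q v).real {y} *
      (1 - agree P x y) := fun x y =>
    mul_nonneg (by positivity) (sub_nonneg.2 (agree_le_one P x y))
  have h1 : (copyLaw G q v).real {v} * (copyLaw G q v).real {w} * (1 - agree P v w) ≤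
      1 - copyAgree G q P v v := by
    rw [one_sub_copyAgree_self]
    refine le_trans ?_ (Finset.single_le_sum (fun x _ => Finset.sum_nonneg fun y _ => hterm x y)
      (Finset.mem_univ v))
    exact Finset.single_le_sum (f := fun y => (copyLaw G q v).real {v} *
      (copyLaw G q v).real {y} * (1 - agree P v y)) (fun y _ => hterm v y) (Finset.mem_univ w)
  have h2 : agree P v w = 0 := by simp [agree, hP]
  rw [copyLaw_real_singleton G q (hG v), copyLaw_real_singleton G q (hG v), h2] at h1
  simp [hadj, hadj.ne] at h1
  have hq : 0 ≤ (q : ℝ) * (1 - q) := mul_nonneg q.2.1 (sub_nonneg.2 q.2.2)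
  calc (q : ℝ) * (1 - q) ≤ (G.degree v : ℝ) * (q * (1 - q)) := le_mul_of_one_le_left hq hd
    _ = (G.degree v : ℝ) * G.degree v * ((1 - q) * (q * (G.degree v : ℝ)⁻¹)) := by
        field_simp
    _ ≤ _ := by gcongr

open Classical in
/-- In expectation the agreement weight increases by at least `q (1 - q)` in a round that does not
start from a consensus. -/
theorem agreementWeight_add_le_integral (hG : G.Connected) (hd : ∀ v, 0 < G.degree v)
    (P : Profile V A) :
    agreementWeight G P + (q : ℝ) * (1 - q) * (if IsConsensus P then 0 else 1) ≤
      ∫ σ, agreementWeight G (step P σ) ∂(Measure.pi fun v : V => copyLaw G q v) := by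
  have hint : ∫ σ, agreementWeight G (step P σ) ∂(Measure.pi fun v : V => copyLaw G q v) =
      ∑ v, ∑ w, (G.degree v : ℝ) * G.degree w *
        (if v = w then 1 else copyAgree G q P v w) := by
    unfold agreementWeight
    rw [integral_finsetSum _ fun _ _ => Integrable.of_finite]
    refine Finset.sum_congr rfl fun v _ => ?_
    rw [integral_finsetSum _ fun _ _ => Integrable.of_finite]
    refine Finset.sum_congr rfl fun w _ => ?_
    rw [integral_const_mul]
    congr 1
    split_ifs with h
    · subst h; simp [agree]
    · exact integral_pi_copyLaw_eval₂ G q h (agree P)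
  have hsplit : ∑ v, ∑ w, (G.degree v : ℝ) * G.degree w *
        (if v = w then 1 else copyAgree G q P v w) = agreementWeight G P +
      ∑ v, (G.degree v : ℝ) * G.degree v * (1 - copyAgree G q P v v) := by
    -- The true mean and the one for independent choices differ only in the terms `w = v`.
    rw [← sum_degree_mul_copyAgree G q hd P, ← Finset.sum_add_distrib]
    refine Finset.sum_congr rfl fun v _ => ?_
    rw [← sub_eq_iff_eq_add', ← Finset.sum_sub_distrib,
      Finset.sum_eq_single v (fun w _ hw => by simp [hw.symm]) (by simp)]
    simp; ring
  have hnn : ∀ v, 0 ≤ (G.degree v : ℝ) * G.degree v * (1 - copyAgree G q P v v) := fun v =>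
    mul_nonneg (by positivity) (sub_nonneg.2 (copyAgree_self_le_one G q P v))
  rw [hint, hsplit]
  gcongr
  split_ifs with hP
  · simpa using Finset.sum_nonneg fun v _ => hnn v
  · obtain ⟨v, w, hadj, hne⟩ := exists_adj_ne_of_not_isConsensus G hG hP
    rw [mul_one]
    exact (le_degree_sq_mul_one_sub_copyAgree G q hd P hadj hne).trans
      (Finset.single_le_sum (fun v _ => hnn v) (Finset.mem_univ v))

open Classical in
/-- The degree weight is preserved in expectation. -/
theorem integral_degreeWeight_step (hd : ∀ v, 0 < G.degree v) (P : Profile V A) (a b : A) :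
    ∫ σ, (degreeWeight G (step P σ) a b : ℝ) ∂(Measure.pi fun v : V => copyLaw G q v) =
      degreeWeight G P a b := by
  have hw : ∀ Q : Profile V A, (degreeWeight G Q a b : ℝ) =
      ∑ v, (G.degree v : ℝ) * (if (Q v).1 a b then 1 else 0) := fun Q => by
    simp only [degreeWeight, Nat.cast_sum, mul_ite, mul_one, mul_zero]
    refine Finset.sum_congr rfl fun v _ => ?_
    split_ifs
    · congr!
    · simp
  simp_rw [hw]
  rw [integral_finsetSum _ fun _ _ => Integrable.of_finite]
  have hv : ∀ v, ∫ σ, (G.degree v : ℝ) * (if (step P σ v).1 a b then 1 else 0)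
        ∂(Measure.pi fun v : V => copyLaw G q v) =
      ∑ x, (G.degree v : ℝ) * (copyLaw G q v).real {x} * (if (P x).1 a b then 1 else 0) :=
    fun v => by
      rw [integral_const_mul]
      refine (congrArg _ (integral_pi_copyLaw_eval G q v
        (fun x => if (P x).1 a b then 1 else 0))).trans ?_
      simp_rw [Finset.mul_sum, mul_assoc]
  rw [Finset.sum_congr rfl fun v _ => hv v, Finset.sum_comm]
  simp_rw [← Finset.sum_mul, sum_degree_mul_copyLaw G q hd]

end Drift

end RandomPD

namespace RandomPD

/-! ### Deterministic and measurability facts about sequences of profiles -/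

section Paths

variable {V A : Type*} [MeasurableSpace V] (G : SimpleGraph V) (q : unitInterval)

theorem IsConsensus.step_eq {P : Profile V A} (hP : IsConsensus P) (s : V → V) : step P s = P :=
  funext fun v => hP (s v) v

theorem IsConsensus.isFixed {P : Profile V A} (hP : IsConsensus P) : IsFixed G q P :=
  fun s _ => hP.step_eq s

open Classical in
/-- The convergence time is at most the number of rounds without consensus. -/
theorem convergenceTime_le_tsum (p : ℕ → Profile V A) :
    convergenceTime G q p ≤ ∑' t, if IsConsensus (p t) then 0 else 1 := by
  by_cases h : ∃ t, IsConsensus (p t)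
  · calc convergenceTime G q p ≤ (Nat.find h : ℝ≥0∞) :=
          iInf₂_le (f := fun (t : ℕ) (_ : IsFixed G q (p t)) => (t : ℝ≥0∞)) _
            ((Nat.find_spec h).isFixed G q)
      _ = ∑ t ∈ Finset.range (Nat.find h), if IsConsensus (p t) then 0 else 1 := by
          rw [Finset.sum_congr rfl fun t ht => if_neg (Nat.find_min h (Finset.mem_range.1 ht))]
          simp
      _ ≤ _ := ENNReal.sum_le_tsum _
  -- Without any consensus the series is a sum of infinitely many ones, hence `∞`.
  · push Not at h
    simp [h]

open Classical in
-- The second alternative makes a witness exist for every sequence, so that `Nat.find` gives a total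
-- and measurable `finalOrder`.
theorem consensus_or_never (p : ℕ → Profile V A) :
    ∃ t, IsConsensus (p t) ∨ ∀ r, ¬ IsConsensus (p r) := by
  by_cases h : ∃ t, IsConsensus (p t)
  · exact h.imp fun t ht => Or.inl ht
  · exact ⟨0, Or.inr (not_exists.1 h)⟩

open Classical in
/-- The order of the node `v` in the first consensus of a sequence of profiles. -/
noncomputable def finalOrder (v : V) (p : ℕ → Profile V A) : StrictOrder A :=
  p (Nat.find (consensus_or_never p)) v

/-- The sequence reaches a consensus, and stays there. -/
def Settles (p : ℕ → Profile V A) : Prop :=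
  (∃ t, IsConsensus (p t)) ∧ ∀ t, IsConsensus (p t) → p (t + 1) = p t

theorem Settles.exists_forall_ge {p : ℕ → Profile V A} (hp : Settles p) (v₀ : V) :
    ∃ T, ∀ t, T ≤ t → IsConsensus (p t) ∧ ∀ v, p t v = finalOrder v₀ p := by
  classical
  obtain ⟨⟨t₀, ht₀⟩, hstep⟩ := hp
  have hT : IsConsensus (p (Nat.find (consensus_or_never p))) :=
    (Nat.find_spec (consensus_or_never p)).resolve_right fun h => h t₀ ht₀
  refine ⟨Nat.find (consensus_or_never p), fun t ht => ?_⟩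
  have h : p t = p (Nat.find (consensus_or_never p)) := by
    induction t, ht using Nat.le_induction with
    | base => rfl
    | succ t _ ih => rw [hstep t (ih ▸ hT), ih]
  rw [h]
  exact ⟨hT, fun v => hT v v₀⟩

theorem measurableSet_isConsensus [Finite V] [Finite A] (t : ℕ) :
    MeasurableSet {p : ℕ → Profile V A | IsConsensus (p t)} := by
  have : Finite (StrictOrder A) := inferInstanceAs (Finite (Subtype _))
  have ht : Measurable fun p : ℕ → Profile V A => p t := measurable_pi_apply t
  exact ht (MeasurableSet.of_discrete (s := {P : Profile V A | IsConsensus P}))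

theorem measurableSet_settles [Finite V] [Finite A] :
    MeasurableSet {p : ℕ → Profile V A | Settles p} := by
  have : Finite (StrictOrder A) := inferInstanceAs (Finite (Subtype _))
  have h1 : {p : ℕ → Profile V A | Settles p} = (⋃ t, {p | IsConsensus (p t)}) ∩
      ⋂ t, ({p | IsConsensus (p t)}ᶜ ∪ {p | p (t + 1) = p t}) := by
    ext p
    simp [Settles, imp_iff_not_or]
  rw [h1]
  refine (MeasurableSet.iUnion measurableSet_isConsensus).inter (MeasurableSet.iInter fun t =>
    (measurableSet_isConsensus t).compl.union ?_)
  exact measurableSet_eq_fun (measurable_pi_apply _) (measurable_pi_apply _)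

theorem measurable_finalOrder [Finite V] [Finite A] (v : V) :
    Measurable (finalOrder v : (ℕ → Profile V A) → StrictOrder A) := by
  classical
  refine Measurable.find (f := fun t (p : ℕ → Profile V A) => p t v)
    (p := fun t p => IsConsensus (p t) ∨ ∀ r, ¬ IsConsensus (p r))
    (fun t => (measurable_pi_apply v).comp (measurable_pi_apply t)) (fun t => ?_)
    consensus_or_never
  rw [Set.ofPred_or, Set.ofPred_forall]
  exact (measurableSet_isConsensus t).union
    (MeasurableSet.iInter fun r => (measurableSet_isConsensus r).compl)

end Paths

/-! ### The random trajectory: Markov property, hitting time, final law -/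

section Diffusion

variable {V A : Type*} [Fintype V] [MeasurableSpace V] [DiscreteMeasurableSpace V]
  (G : SimpleGraph V) (q : unitInterval)

instance : IsProbabilityMeasure (choicesLaw G q) := by
  unfold choicesLaw; infer_instance

theorem trajectory_congr (P₀ : Profile V A) {s s' : ℕ → V → V} {t : ℕ}
    (h : ∀ r < t, s r = s' r) : trajectory P₀ s t = trajectory P₀ s' t := by
  induction t with
  | zero => rfl
  | succ t ih => rw [trajectory, trajectory, ih fun r hr => h r (by omega), h t (by omega)]

theorem measurable_trajectory_apply (P₀ : Profile V A) (t : ℕ) :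
    Measurable fun s : ℕ → V → V => trajectory P₀ s t :=
  (measurable_pi_apply t).comp (measurable_trajectory P₀)

/-- The choices of a round are independent of the profile at its start. -/
theorem indepFun_trajectory (P₀ : Profile V A) (t : ℕ) :
    IndepFun (fun s : ℕ → V → V => trajectory P₀ s t) (fun s => s t) (choicesLaw G q) := by
  have hind : iIndepFun (fun (i : ℕ) (s : ℕ → V → V) => s i) (choicesLaw G q) :=
    iIndepFun_infinitePi (X := fun _ x => x) (fun i => measurable_id)
  have h := hind.indepFun_finset (Finset.range t) {t} (by simp) fun i => measurable_pi_apply i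
  -- The profile at time `t` depends only on the choices before `t`, so it factors through this
  -- finite window; the filler `id` for later rounds is never read.
  let extend : (Finset.range t → V → V) → ℕ → V → V :=
    fun s i => if hi : i ∈ Finset.range t then s ⟨i, hi⟩ else id
  have hext : Measurable extend := by
    refine measurable_pi_lambda _ fun i => ?_
    by_cases hi : i ∈ Finset.range t
    · simp only [extend, hi, dite_true]
      exact measurable_pi_apply _
    · simp only [extend, hi, dite_false]
      exact measurable_const
  have hlast : Measurable fun f : ({t} : Finset ℕ) → V → V => f ⟨t, Finset.mem_singleton_self t⟩ :=
    measurable_pi_apply _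
  have h' := h.comp ((measurable_trajectory_apply P₀ t).comp hext)
    hlast
  have heq : (fun s : ℕ → V → V => trajectory P₀ s t) =
      ((fun s => trajectory P₀ s t) ∘ extend) ∘ fun s i => s i :=
    funext fun s => trajectory_congr P₀ fun r hr => by simp [extend, hr]
  rw [heq]
  exact h'

variable [Finite A]

/-- The Markov property in integrated form: by independence the joint law is a product, and Fubini
applies. -/
theorem integral_trajectory_succ (P₀ : Profile V A) (t : ℕ) (h : Profile V A → ℝ) :
    ∫ s, h (trajectory P₀ s (t + 1)) ∂(choicesLaw G q) =
      ∫ s, (∫ σ, h (step (trajectory P₀ s t) σ) ∂(Measure.pi fun v : V => copyLaw G q v))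
        ∂(choicesLaw G q) := by
  have : Finite (StrictOrder A) := inferInstanceAs (Finite (Subtype _))
  have hm := measurable_trajectory_apply P₀ t
  have hmap := (indepFun_iff_map_prod_eq_prod_map_map hm.aemeasurable
    (measurable_pi_apply t).aemeasurable).1 (indepFun_trajectory G q P₀ t)
  have hlaw : (choicesLaw G q).map (fun s => s t) = Measure.pi fun v : V => copyLaw G q v :=
    Measure.infinitePi_map_eval _ t
  rw [hlaw] at hmap
  have : IsProbabilityMeasure ((choicesLaw G q).map fun s => trajectory P₀ s t) :=
    Measure.isProbabilityMeasure_map hm.aemeasurable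
  calc ∫ s, h (trajectory P₀ s (t + 1)) ∂(choicesLaw G q)
      = ∫ z, h (step z.1 z.2) ∂((choicesLaw G q).map fun s => (trajectory P₀ s t, s t)) := by
        rw [integral_map (hm.prodMk (measurable_pi_apply t)).aemeasurable
          Measurable.of_discrete.aestronglyMeasurable]
        rfl
    _ = _ := by
        rw [hmap, integral_prod _ Integrable.of_finite, integral_map hm.aemeasurable
          Measurable.of_discrete.aestronglyMeasurable]

theorem integrable_trajectory (P₀ : Profile V A) (t : ℕ) (h : Profile V A → ℝ) :
    Integrable (fun s => h (trajectory P₀ s t)) (choicesLaw G q) := by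
  have : Finite (StrictOrder A) := inferInstanceAs (Finite (Subtype _))
  exact (Integrable.of_finite (f := h)).comp_measurable (measurable_trajectory_apply P₀ t)

theorem measurableSet_isConsensus_trajectory (P₀ : Profile V A) (t : ℕ) :
    MeasurableSet {s : ℕ → V → V | IsConsensus (trajectory P₀ s t)} :=
  measurable_trajectory P₀ (measurableSet_isConsensus t)

theorem measurableSet_not_isConsensus_trajectory (P₀ : Profile V A) (t : ℕ) :
    MeasurableSet {s : ℕ → V → V | ¬ IsConsensus (trajectory P₀ s t)} :=
  (measurableSet_isConsensus_trajectory P₀ t).compl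

variable [DecidableEq V] [DecidableRel G.Adj]

theorem integral_degreeWeight_trajectory (hd : ∀ v, 0 < G.degree v) (P₀ : Profile V A)
    (a b : A) (t : ℕ) :
    ∫ s, (degreeWeight G (trajectory P₀ s t) a b : ℝ) ∂(choicesLaw G q) =
      degreeWeight G P₀ a b := by
  induction t with
  | zero => simp [trajectory]
  | succ t ih =>
    rw [integral_trajectory_succ G q P₀ t (fun P => (degreeWeight G P a b : ℝ))]
    simp_rw [integral_degreeWeight_step G q hd]
    exact ih

theorem integral_agreementWeight_succ (hG : G.Connected) (hd : ∀ v, 0 < G.degree v)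
    (P₀ : Profile V A) (t : ℕ) :
    ∫ s, agreementWeight G (trajectory P₀ s t) ∂(choicesLaw G q) + (q : ℝ) * (1 - q) *
        (choicesLaw G q).real {s | ¬ IsConsensus (trajectory P₀ s t)} ≤
      ∫ s, agreementWeight G (trajectory P₀ s (t + 1)) ∂(choicesLaw G q) := by
  classical
  have hind : (choicesLaw G q).real {s | ¬ IsConsensus (trajectory P₀ s t)} =
      ∫ s, (if IsConsensus (trajectory P₀ s t) then 0 else 1 : ℝ) ∂(choicesLaw G q) := by
    rw [← integral_indicator_one (measurableSet_not_isConsensus_trajectory P₀ t)]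
    refine integral_congr_ae (.of_forall fun s => ?_)
    by_cases hs : IsConsensus (trajectory P₀ s t) <;> simp [hs]
  rw [integral_trajectory_succ G q P₀ t (agreementWeight G), hind, ← integral_const_mul,
    ← integral_add (integrable_trajectory G q P₀ t (agreementWeight G))
      (integrable_trajectory G q P₀ t
        fun P => (q : ℝ) * (1 - q) * if IsConsensus P then 0 else 1)]
  exact integral_mono (integrable_trajectory G q P₀ t
      fun P => agreementWeight G P + (q : ℝ) * (1 - q) * if IsConsensus P then 0 else 1)
    (integrable_trajectory G q P₀ t fun P =>
      ∫ σ, agreementWeight G (step P σ) ∂(Measure.pi fun v : V => copyLaw G q v))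
    fun s => agreementWeight_add_le_integral G q hG hd _

/-- The one-round drifts telescope from a nonnegative initial potential to one bounded by `n ^ 4`,
uniformly in `T`. -/
theorem sum_not_isConsensus_le (hG : G.Connected) (hd : ∀ v, 0 < G.degree v)
    (P₀ : Profile V A) (T : ℕ) :
    (q : ℝ) * (1 - q) * ∑ t ∈ Finset.range T,
        (choicesLaw G q).real {s | ¬ IsConsensus (trajectory P₀ s t)} ≤
      (Fintype.card V : ℝ) ^ 4 := by
  have h : (q : ℝ) * (1 - q) * ∑ t ∈ Finset.range T,
        (choicesLaw G q).real {s | ¬ IsConsensus (trajectory P₀ s t)} ≤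
      ∫ s, agreementWeight G (trajectory P₀ s T) ∂(choicesLaw G q) := by
    induction T with
    | zero => simpa using integral_nonneg fun s => agreementWeight_nonneg G _
    | succ T ih =>
      rw [Finset.sum_range_succ, mul_add]
      linarith [integral_agreementWeight_succ G q hG hd P₀ T]
  refine h.trans ((integral_mono (integrable_trajectory G q P₀ T (agreementWeight G))
    (integrable_const _) fun s => agreementWeight_le G _).trans ?_)
  simp

open Classical in
/-- The expected number of rounds that do not start from a consensus is `O(n⁴)`. -/
theorem lintegral_tsum_not_isConsensus_le (hq0 : 0 < q) (hq1 : q < 1) (hG : G.Connected)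
    (hd : ∀ v, 0 < G.degree v) (P₀ : Profile V A) :
    ∫⁻ s, ∑' t, (if IsConsensus (trajectory P₀ s t) then 0 else 1) ∂(choicesLaw G q) ≤
      (Real.toNNReal ((q : ℝ) * (1 - q))⁻¹ : ℝ≥0∞) * (Fintype.card V : ℝ≥0∞) ^ 4 := by
  have hc : 0 < (q : ℝ) * (1 - q) := mul_pos hq0 (sub_pos.2 hq1)
  have hterm : ∀ t, ∫⁻ s, (if IsConsensus (trajectory P₀ s t) then 0 else 1 : ℝ≥0∞)
      ∂(choicesLaw G q) = choicesLaw G q {s | ¬ IsConsensus (trajectory P₀ s t)} := fun t => by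
    rw [← lintegral_indicator_one (measurableSet_not_isConsensus_trajectory P₀ t)]
    refine lintegral_congr fun s => ?_
    by_cases hs : IsConsensus (trajectory P₀ s t) <;> simp [hs]
  rw [lintegral_tsum fun t => (Measurable.ite (measurableSet_isConsensus_trajectory P₀ t)
    measurable_const measurable_const).aemeasurable]
  simp_rw [hterm]
  rw [ENNReal.tsum_eq_iSup_nat]
  refine iSup_le fun T => ?_
  have h := sum_not_isConsensus_le G q hG hd P₀ T
  have hr : (Real.toNNReal ((q : ℝ) * (1 - q))⁻¹ : ℝ≥0∞) * (Fintype.card V : ℝ≥0∞) ^ 4 =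
      ENNReal.ofReal (((q : ℝ) * (1 - q))⁻¹ * (Fintype.card V : ℝ) ^ 4) := by
    rw [ENNReal.ofReal_mul (inv_nonneg.2 hc.le), ENNReal.ofReal_pow (by positivity)]
    simp [ENNReal.ofReal]
  rw [hr, Finset.sum_congr rfl fun t _ => (ofReal_measureReal (μ := choicesLaw G q)).symm,
    ← ENNReal.ofReal_sum_of_nonneg fun t _ => measureReal_nonneg]
  refine ENNReal.ofReal_le_ofReal ?_
  rwa [← div_eq_inv_mul, le_div_iff₀' hc]

/-- A random count with finite mean is almost surely finite, so not every round lacks consensus. -/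
theorem ae_settles_trajectory (hq0 : 0 < q) (hq1 : q < 1) (hG : G.Connected)
    (hd : ∀ v, 0 < G.degree v) (P₀ : Profile V A) :
    ∀ᵐ s ∂(choicesLaw G q), Settles (trajectory P₀ s) := by
  classical
  have hne : ∫⁻ s, ∑' t, (if IsConsensus (trajectory P₀ s t) then 0 else 1 : ℝ≥0∞)
      ∂(choicesLaw G q) ≠ ∞ :=
    ((lintegral_tsum_not_isConsensus_le G q hq0 hq1 hG hd P₀).trans_lt
      (ENNReal.mul_lt_top ENNReal.coe_lt_top (by finiteness))).ne
  have hm : Measurable fun s => ∑' t, (if IsConsensus (trajectory P₀ s t) then 0 else 1 : ℝ≥0∞) :=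
    Measurable.tsum fun t => Measurable.ite (measurableSet_isConsensus_trajectory P₀ t)
      measurable_const measurable_const
  filter_upwards [ae_lt_top hm hne] with s hs
  refine ⟨?_, fun t ht => ht.step_eq _⟩
  by_contra! h
  simp [h] at hs

theorem degreeWeight_of_forall_eq {P : Profile V A} {r : StrictOrder A} (hP : ∀ v, P v = r)
    (a b : A) [Decidable (r.1 a b)] :
    (degreeWeight G P a b : ℝ) = if r.1 a b then 2 * (G.edgeFinset.card : ℝ) else 0 := by
  unfold degreeWeight
  simp_rw [hP]
  split_ifs with h
  · have := G.sum_degrees_eq_twice_card_edges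
    rw [← Nat.cast_ofNat, ← Nat.cast_mul, ← this]
    congr!
  · simp

/-- The constant mean of the degree weight passes to the limit, where the weight is `2m` times the
indicator of the event. -/
theorem measureReal_finalOrder (hq0 : 0 < q) (hq1 : q < 1) (hG : G.Connected)
    (hd : ∀ v, 0 < G.degree v) (P₀ : Profile V A) (v₀ : V) (a b : A) :
    (choicesLaw G q).real {s | (finalOrder v₀ (trajectory P₀ s)).1 a b} =
      (degreeWeight G P₀ a b : ℝ) / (2 * (G.edgeFinset.card : ℝ)) := by
  classical
  have : Finite (StrictOrder A) := inferInstanceAs (Finite (Subtype _))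
  have hm : 0 < 2 * (G.edgeFinset.card : ℝ) := by
    have h1 : 0 < ∑ v, G.degree v := Finset.sum_pos (fun v _ => hd v) ⟨v₀, Finset.mem_univ _⟩
    rw [G.sum_degrees_eq_twice_card_edges] at h1
    exact_mod_cast h1
  -- There are finitely many profiles, so a constant dominates.
  obtain ⟨B, hB⟩ := (Set.finite_range fun P : Profile V A => (degreeWeight G P a b : ℝ)).bddAbove
  have hmeas : MeasurableSet {s | (finalOrder v₀ (trajectory P₀ s)).1 a b} :=
    ((measurable_finalOrder v₀).comp (measurable_trajectory P₀))
      (MeasurableSet.of_discrete (s := {r : StrictOrder A | r.1 a b}))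
  have hlim := tendsto_integral_of_dominated_convergence (μ := choicesLaw G q)
    (F := fun t s => (degreeWeight G (trajectory P₀ s t) a b : ℝ))
    (f := fun s => if (finalOrder v₀ (trajectory P₀ s)).1 a b then
      2 * (G.edgeFinset.card : ℝ) else 0) (fun _ => B)
    (fun t => (integrable_trajectory G q P₀ t
      fun P => (degreeWeight G P a b : ℝ)).aestronglyMeasurable)
    (integrable_const _)
    (fun t => .of_forall fun s => by
      simpa using hB (Set.mem_range_self (trajectory P₀ s t)))
    (by
      filter_upwards [ae_settles_trajectory G q hq0 hq1 hG hd P₀] with s hs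
      obtain ⟨T, hT⟩ := hs.exists_forall_ge v₀
      refine tendsto_const_nhds.congr' ?_
      filter_upwards [Filter.eventually_ge_atTop T] with t ht
      exact (degreeWeight_of_forall_eq G (hT t ht).2 a b).symm)
  simp_rw [integral_degreeWeight_trajectory G q hd P₀ a b] at hlim
  have heq := tendsto_nhds_unique hlim tendsto_const_nhds
  have hint : ∫ s, (if (finalOrder v₀ (trajectory P₀ s)).1 a b then
      2 * (G.edgeFinset.card : ℝ) else 0) ∂(choicesLaw G q) =
      (choicesLaw G q).real {s | (finalOrder v₀ (trajectory P₀ s)).1 a b} *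
        (2 * (G.edgeFinset.card : ℝ)) := by
    refine Eq.trans ?_ (integral_indicator_const (2 * (G.edgeFinset.card : ℝ)) hmeas)
    rfl
  rw [eq_div_iff hm.ne', ← hint, heq]

end Diffusion

end RandomPD

/-! ### Transfer from the canonical trajectory to any process with the same law -/

theorem theorem4p1 (q : unitInterval) (hq0 : 0 < q) (hq1 : q < 1) :
    ∃ C : ℝ≥0, ∀ (V : Type u) [Fintype V] [DecidableEq V] [Nontrivial V]
      [MeasurableSpace V] [DiscreteMeasurableSpace V]
      (G : SimpleGraph V) [DecidableRel G.Adj], G.Connected →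
      ∀ (A : Type v) [Finite A] (P₀ : Profile V A)
        (Ω : Type w) [MeasurableSpace Ω] (μ : Measure Ω) [IsProbabilityMeasure μ]
        (X : ℕ → Ω → Profile V A),
        HasLaw (fun ω t => X t ω) (RandomPD.processLaw G q P₀) μ →
        (∃ F : Ω → StrictOrder A, Measurable F ∧
          (∀ᵐ ω ∂μ, ∃ T : ℕ, ∀ t : ℕ, T ≤ t →
            RandomPD.IsFixed G q (X t ω) ∧ ∀ v : V, X t ω v = F ω) ∧
          (∀ a b : A, μ.real {ω | (F ω).1 a b} =
            (RandomPD.degreeWeight G P₀ a b : ℝ) / (2 * (G.edgeFinset.card : ℝ)))) ∧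
        ∫⁻ ω, RandomPD.convergenceTime G q (fun t => X t ω) ∂μ ≤
          (C : ℝ≥0∞) * (Fintype.card V : ℝ≥0∞) ^ 4 := by
  classical
  refine ⟨Real.toNNReal ((q : ℝ) * (1 - q))⁻¹, ?_⟩
  intro V _ _ _ _ _ G _ hG A _ P₀ Ω _ μ _ X hX
  have hd : ∀ v, 0 < G.degree v := fun v => hG.preconnected.degree_pos_of_nontrivial v
  obtain ⟨v₀⟩ := hG.nonempty
  have htraj := RandomPD.measurable_trajectory (V := V) P₀
  have hfin := RandomPD.measurable_finalOrder (A := A) v₀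
  have hlaw : HasLaw (fun s => RandomPD.trajectory P₀ s) (RandomPD.processLaw G q P₀)
      (RandomPD.choicesLaw G q) := ⟨htraj.aemeasurable, rfl⟩
  have hsettle : ∀ᵐ ω ∂μ, RandomPD.Settles fun t => X t ω :=
    (hX.ae_iff (measurableSet_setOfPred.1 RandomPD.measurableSet_settles)).2
      ((hlaw.ae_iff (measurableSet_setOfPred.1 RandomPD.measurableSet_settles)).1
        (RandomPD.ae_settles_trajectory G q hq0 hq1 hG hd P₀))
  -- `HasLaw` gives only a.e. measurability of the process; a measurable version makes `F`
  -- measurable.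
  refine ⟨⟨fun ω => RandomPD.finalOrder v₀ (hX.aemeasurable.mk _ ω),
    hfin.comp hX.aemeasurable.measurable_mk, ?_, fun a b => ?_⟩, ?_⟩
  · filter_upwards [hsettle, hX.aemeasurable.ae_eq_mk] with ω hω hmk
    obtain ⟨T, hT⟩ := hω.exists_forall_ge v₀
    refine ⟨T, fun t ht => ⟨(hT t ht).1.isFixed G q, fun v => ?_⟩⟩
    rw [← hmk]
    exact (hT t ht).2 v
  · have hset : MeasurableSet {p : ℕ → Profile V A | (RandomPD.finalOrder v₀ p).1 a b} :=
      hfin (MeasurableSet.of_discrete (s := {r : StrictOrder A | r.1 a b}))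
    rw [← RandomPD.measureReal_finalOrder G q hq0 hq1 hG hd P₀ v₀ a b,
      hlaw.measureReal_eq hset, ← hX.measureReal_eq hset]
    refine measureReal_congr ?_
    filter_upwards [hX.aemeasurable.ae_eq_mk] with ω hmk
    exact congrArg (fun p => (RandomPD.finalOrder v₀ p).1 a b) hmk.symm
  · have hm : Measurable fun p : ℕ → Profile V A =>
        ∑' t, (if RandomPD.IsConsensus (p t) then 0 else 1 : ℝ≥0∞) :=
      Measurable.tsum fun t => Measurable.ite (RandomPD.measurableSet_isConsensus t)
        measurable_const measurable_const
    calc ∫⁻ ω, RandomPD.convergenceTime G q (fun t => X t ω) ∂μ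
        ≤ ∫⁻ ω, ∑' t, (if RandomPD.IsConsensus (X t ω) then 0 else 1 : ℝ≥0∞) ∂μ :=
          -- Passing to the majorant before changing spaces means that only the majorant has to be
          -- measurable.
          lintegral_mono fun ω => RandomPD.convergenceTime_le_tsum G q fun t => X t ω
      _ = ∫⁻ s, ∑' t, (if RandomPD.IsConsensus (RandomPD.trajectory P₀ s t) then 0 else 1 : ℝ≥0∞)
            ∂(RandomPD.choicesLaw G q) :=
          (hX.lintegral_comp hm.aemeasurable).trans (hlaw.lintegral_comp hm.aemeasurable).symm
      _ ≤ _ := RandomPD.lintegral_tsum_not_isConsensus_le G q hq0 hq1 hG hd P₀
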